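/- Fix constants $C_0, C^*, \overline{C} \in (0,\infty)$. For a distribution $F_Y$ of a valuation $Y\in[0,1]$ and a price $p\in[0,1]$, let $R(p,F_Y) = p(1-F_Y(p))$. Let $\mathcal F^U$ be the set of all probability distributions $F_Y$ on $[0,1]$ that have a density $f_Y$ on $[0,1]$ such that (i) $|f_Y(y)-f_Y(y')|\le C_0|y-y'|$ for all $y,y'\in[0,1]$; (ii) $p\mapsto R(p,F_Y)$ is strictly concave on $[0,1]$, and $-2f_Y(y)-y f_Y'(y)\le -C^*$ for almost every $y\in[0,1]$; (iii) $|2f_Y(y)+y f_Y'(y)|\le \overline{C}$ for almost every $y\in[0,1]$; (iv) the maximizer $p_U^*=p_U^*(F_Y)$ of $R(\cdot,F_Y)$ over $[0,1]$ lies in $(0,1)$, and $f_Y$ is continuously differentiable in a neighborhood of $p_U^*$. For a sample $Y_1,\dots,Y_n\in[0,1]$, let $\hat F(p)=\frac1n\#\{i: Y_i\le p\}$ be the empirical CDF and $\hat F(p-)=\frac1n\#\{i: Y_i<p\}$ its left limit, and let $\hat p_U=\hat p_U(Y_1,\dots,Y_n)$ be a uniform empirical revenue maximization (ERM) price, that is,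 any measurable selection from $$\arg\max_{p\in[0,1]}\; p\,(1-\hat F(p-)) = \arg\max_{p\in[0,1]}\; p\cdot\frac1n\#\{i: Y_i\ge p\}.$$ Then there is a constant $C\in(0,\infty)$, depending only on $C_0, C^*, \overline{C}$, such that for every $n\ge1$ and every such $\hat p_U$, $$\sup_{F_Y\in\mathcal F^U}\Big(R(p_U^*,F_Y)-\mathbb E_{F_Y}\big[R(\hat p_U(Y_1,\dots,Y_n),F_Y)\big]\Big)\le C\,n^{-2/3},$$ where the expectation is over $Y_1,\dots,Y_n$ i.i.d. from $F_Y$. -/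

import Mathlib

open MeasureTheory

namespace UniformPricing

/-- Expected revenue `R(p, F_Y) = p (1 - F_Y(p))` of the uniform price `p`, when the valuation `Y`
has law `μ`. -/
noncomputable def revenue (μ : Measure ℝ) (p : ℝ) : ℝ :=
  p * (1 - ProbabilityTheory.cdf μ p)

/-- The revenue `R(p_U^*, F_Y)` of the true-distribution optimal uniform price, that is, the
supremum of the revenue over all prices in `[0, 1]`. -/
noncomputable def optRevenue (μ : Measure ℝ) : ℝ :=
  sSup (revenue μ '' Set.Icc 0 1)

/-- `f` (used only on `[0, 1]`) is a probability density on `[0, 1]` of the law `μ`. -/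
structure IsDensity (μ : Measure ℝ) (f : ℝ → ℝ) : Prop where
  nonneg : ∀ y ∈ Set.Icc (0 : ℝ) 1, 0 ≤ f y
  eq_withDensity :
    μ = (volume.restrict (Set.Icc (0 : ℝ) 1)).withDensity (fun y => ENNReal.ofReal (f y))

/-- The class `𝓕^U` of laws `F_Y` of valuations in `[0, 1]`, for given constants: `C₀` (Lipschitz
constant of the density), `Cs` (strong concavity of the revenue) and `Cb` (bound on the second
derivative of the revenue). The second derivative of the revenue is `-2 f(y) - y f'(y)`; the
Lipschitz density `f` is differentiable almost everywhere. -/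
def marginalClass (C₀ Cs Cb : ℝ) : Set (Measure ℝ) :=
  {μ | IsProbabilityMeasure μ ∧ ∃ f : ℝ → ℝ, IsDensity μ f ∧
    (∀ y ∈ Set.Icc (0 : ℝ) 1, ∀ y' ∈ Set.Icc (0 : ℝ) 1, |f y - f y'| ≤ C₀ * |y - y'|) ∧
    StrictConcaveOn ℝ (Set.Icc 0 1) (revenue μ) ∧
    (∀ᵐ y ∂(volume.restrict (Set.Icc (0 : ℝ) 1)), -2 * f y - y * deriv f y ≤ -Cs) ∧
    (∀ᵐ y ∂(volume.restrict (Set.Icc (0 : ℝ) 1)), |2 * f y + y * deriv f y| ≤ Cb) ∧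
    ∃ p ∈ Set.Ioo (0 : ℝ) 1, IsMaxOn (revenue μ) (Set.Icc 0 1) p ∧ ContDiffAt ℝ 1 f p}

/-- The empirical CDF `F̂(p) = n⁻¹ #{i : y i ≤ p}` of the sample `y`. -/
noncomputable def empCDF {n : ℕ} (y : Fin n → ℝ) (p : ℝ) : ℝ :=
  ((Finset.univ.filter fun i => y i ≤ p).card : ℝ) / n

/-- Empirical revenue `p (1 - F̂(p-)) = p · n⁻¹ #{i : y i ≥ p}` of the price `p`: a buyer whose
valuation equals the price buys. With the right-continuous `F̂(p)` in place of the left limit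
`F̂(p-)` the supremum over `[0, 1]` is the same (`isLUB_of_isERMPrice`), but it is not attained
unless all `y i` vanish. -/
noncomputable def empRevenue {n : ℕ} (y : Fin n → ℝ) (p : ℝ) : ℝ :=
  p * (((Finset.univ.filter fun i => p ≤ y i).card : ℝ) / n)

/-- `p` is an empirical revenue maximizing price in `[0, 1]` for the sample `y`. -/
def IsERMPrice {n : ℕ} (y : Fin n → ℝ) (p : ℝ) : Prop :=
  p ∈ Set.Icc (0 : ℝ) 1 ∧ IsMaxOn (empRevenue y) (Set.Icc 0 1) p

/-- `phat` is a uniform ERM strategy: a measurable function of the data that selects, for each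
sample of valuations in `[0, 1]`, an empirical revenue maximizing price (with any rule for ties). -/
def IsERMStrategy {n : ℕ} (phat : (Fin n → ℝ) → ℝ) : Prop :=
  Measurable phat ∧ ∀ y : Fin n → ℝ, (∀ i, y i ∈ Set.Icc (0 : ℝ) 1) → IsERMPrice y (phat y)

/-- The maximal empirical revenue is the supremum of `p (1 - F̂(p))` over `p ∈ [0, 1]`. -/
theorem isLUB_of_isERMPrice {n : ℕ} (hn : 1 ≤ n) (y : Fin n → ℝ) (p : ℝ) (hp : IsERMPrice y p) :
    IsLUB ((fun q => q * (1 - empCDF y q)) '' Set.Icc 0 1) (empRevenue y p) := by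
  have hn0 : (0 : ℝ) < n := by exact_mod_cast hn
  have key : ∀ q, 1 - empCDF y q = ((Finset.univ.filter fun i => q < y i).card : ℝ) / n := by
    intro q
    have h := Finset.card_filter_add_card_filter_not (s := (Finset.univ : Finset (Fin n)))
      (fun i => y i ≤ q)
    simp only [not_le, Finset.card_univ, Fintype.card_fin] at h
    have h2 : ((Finset.univ.filter fun i => y i ≤ q).card : ℝ)
        + ((Finset.univ.filter fun i => q < y i).card : ℝ) = n := by exact_mod_cast h
    unfold empCDF
    field_simp
    linarith
  constructor
  · rintro _ ⟨q, hq, rfl⟩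
    refine le_trans ?_ (hp.2 hq)
    simp only [key, empRevenue]
    refine mul_le_mul_of_nonneg_left ?_ hq.1
    gcongr with i
    exact le_of_lt
  · intro b hb
    rcases hp.1.1.eq_or_lt with h0 | h0
    · have := hb ⟨0, by simp, rfl⟩
      simpa [empRevenue, ← h0] using this
    · set a : ℝ := ((Finset.univ.filter fun i => p ≤ y i).card : ℝ) / n with ha
      have hlim : Filter.Tendsto (fun q : ℝ => q * a) (nhdsWithin p (Set.Iio p)) (nhds (p * a)) :=
        ((continuous_id.mul continuous_const).tendsto p).mono_left nhdsWithin_le_nhds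
      refine le_of_tendsto hlim ?_
      filter_upwards [Ioo_mem_nhdsLT h0] with q hq
      have hb' := hb ⟨q, ⟨hq.1.le, hq.2.le.trans hp.1.2⟩, rfl⟩
      refine le_trans ?_ hb'
      simp only [key, ha]
      refine mul_le_mul_of_nonneg_left ?_ hq.1.le
      gcongr
      exact hq.2

/-- Uniform ERM strategies exist for every sample size. -/
theorem exists_isERMStrategy (n : ℕ) : ∃ phat : (Fin n → ℝ) → ℝ, IsERMStrategy phat := by
  classical
  rcases Nat.eq_zero_or_pos n with rfl | hn
  · refine ⟨fun _ => 0, measurable_const, fun y _ => ⟨by simp, fun q _ => ?_⟩⟩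
    simp [empRevenue]
  have : Nonempty (Fin n) := ⟨⟨0, hn⟩⟩
  have hmeas : ∀ i : Fin n, Measurable fun y : Fin n → ℝ => empRevenue y (y i) := by
    intro i
    have : (fun y : Fin n → ℝ => empRevenue y (y i))
        = fun y => y i * ((∑ j, if y i ≤ y j then (1 : ℝ) else 0) / n) := by
      funext y
      simp [empRevenue]
    rw [this]
    refine (measurable_pi_apply i).mul (Measurable.div_const ?_ _)
    refine Finset.measurable_sum _ fun j _ => ?_
    exact Measurable.ite (measurableSet_le (measurable_pi_apply i) (measurable_pi_apply j))
      measurable_const measurable_const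
  have hP : ∀ y : Fin n → ℝ, ∃ i, ∀ j, empRevenue y (y j) ≤ empRevenue y (y i) :=
    fun y => Finite.exists_max fun i => empRevenue y (y i)
  let good (y : Fin n → ℝ) (i : Fin n) : Prop := ∀ j, empRevenue y (y j) ≤ empRevenue y (y i)
  have hgood : ∀ i, MeasurableSet {y | good y i} := by
    intro i
    simp only [good, Set.ofPred_forall]
    exact MeasurableSet.iInter fun j => measurableSet_le (hmeas j) (hmeas i)
  have hmin : ∀ y : Fin n → ℝ, ∃ i, good y i ∧ ∀ j, j < i → ¬ good y j := by
    intro y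
    have hw : WellFounded ((· < ·) : Fin n → Fin n → Prop) := wellFounded_lt
    exact ⟨hw.min {i | good y i} (hP y), hw.min_mem _ (hP y),
      fun j hj hg => hw.not_lt_min {i | good y i} hg hj⟩
  choose idx hidx hidx' using hmin
  have hidxm : Measurable idx := by
    refine measurable_to_countable' fun i => ?_
    have : idx ⁻¹' {i} = {y | good y i} ∩ ⋂ j, ⋂ (_ : j < i), {y | good y j}ᶜ := by
      ext y
      simp only [Set.mem_preimage, Set.mem_singleton_iff, Set.mem_inter_iff, Set.mem_ofPred_eq,
        Set.mem_iInter, Set.mem_compl_iff]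
      constructor
      · rintro rfl
        exact ⟨hidx y, hidx' y⟩
      · rintro ⟨h1, h2⟩
        rcases lt_trichotomy (idx y) i with h | h | h
        · exact absurd (hidx y) (h2 _ h)
        · exact h
        · exact absurd h1 (hidx' y _ h)
    rw [this]
    exact (hgood i).inter (MeasurableSet.iInter fun j => MeasurableSet.iInter fun _ =>
      (hgood j).compl)
  refine ⟨fun y => y (idx y), ?_, fun y hy => ⟨hy _, fun q hq => ?_⟩⟩
  · have huncurry : Measurable fun z : Fin n × (Fin n → ℝ) => z.2 z.1 :=
      measurable_from_prod_countable_right fun i => measurable_pi_apply i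
    exact huncurry.comp (hidxm.prodMk measurable_id)
  · change empRevenue y q ≤ empRevenue y (y (idx y))
    by_cases hne : (Finset.univ.filter fun i => q ≤ y i).Nonempty
    · obtain ⟨j, hj, hjmin⟩ := Finset.exists_min_image _ y hne
      refine le_trans ?_ (hidx y j)
      have hqj : q ≤ y j := (Finset.mem_filter.mp hj).2
      unfold empRevenue
      have hsub : (Finset.univ.filter fun i => q ≤ y i) ⊆ (Finset.univ.filter fun i => y j ≤ y i) :=
        fun i hi => Finset.mem_filter.mpr ⟨Finset.mem_univ _, hjmin i hi⟩
      have hc := Finset.card_le_card hsub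
      have h0 := (hy j).1
      gcongr
    · rw [Finset.not_nonempty_iff_eq_empty] at hne
      have : empRevenue y q = 0 := by simp [empRevenue, hne]
      rw [this]
      exact mul_nonneg (hy _).1 (by positivity)

end UniformPricing

/-! Let `p₀` be the optimal price and `r` the regret of the empirical price `t`. Since `t` beats
`p₀` on the sample, `r` is at most the centered empirical fluctuation of the revenue difference
between `t` and `p₀`. A uniform bound on that fluctuation would only give the rate `n^(-1/2)`. The
gain comes from curvature: the revenue falls quadratically away from `p₀`
(`revenue_quadratic_drop`), so only fluctuations near `p₀` matter.

Instead of peeling into shells, the fluctuation is divided by `D(t) = √((t - p₀)² + δ²)`. If `X` is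
the normalized sum, then `r ≤ D X / n`, and Young's inequality with the quadratic drop gives `r ≤ c
δ² + X² / (c n²)`.

It remains to show `𝔼 X² = O(n / δ)` although `t` depends on the data. Symmetrization
(`integral_sq_empirical_le`) reduces this to Rademacher sums with a sign-dependent price. The buyers
valued between `p₀` and `t` form an initial segment in the order of distance from `p₀`, so a
weighted Doob-type maximal inequality (`sum_sq_signSum_le`) bounds the second moment by the sum of
`1 / D(y i)²`. As the density is bounded, each term has mean `O(1 / δ)`. `regret_le` assembles this,
and `δ = n^(-1/3)` balances the two errors. -/

namespace UniformPricing

/-! ### Maximal inequality for weighted Rademacher sums. -/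

section Signs

variable {ι : Type*} [DecidableEq ι]

/-- The sign `±1` encoded by a Boolean. -/
def boolSign (b : Bool) : ℝ := if b then 1 else -1

@[simp] lemma boolSign_not (b : Bool) : boolSign (!b) = -boolSign b := by
  cases b <;> simp [boolSign]

@[simp] lemma boolSign_sq (b : Bool) : boolSign b ^ 2 = 1 := by
  cases b <;> simp [boolSign]

/-- Flip the sign with index `a`. -/
def flipSign (a : ι) (ε : ι → Bool) : ι → Bool := Function.update ε a (!ε a)

lemma flipSign_involutive (a : ι) : Function.Involutive (flipSign a : (ι → Bool) → ι → Bool) := by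
  intro ε
  simp [flipSign]

@[simp] lemma flipSign_self (a : ι) (ε : ι → Bool) : flipSign a ε a = !ε a := by
  simp [flipSign]

lemma flipSign_of_ne {a i : ι} (h : i ≠ a) (ε : ι → Bool) : flipSign a ε i = ε i := by
  simp [flipSign, h]

/-- The Rademacher sum over `s` with weights `w`. -/
def signSum (w : ι → ℝ) (s : Finset ι) (ε : ι → Bool) : ℝ := ∑ i ∈ s, w i * boolSign (ε i)

lemma signSum_insert (w : ι → ℝ) {s : Finset ι} {a : ι} (ha : a ∉ s) (ε : ι → Bool) :
    signSum w (insert a s) ε = w a * boolSign (ε a) + signSum w s ε := by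
  simp [signSum, Finset.sum_insert ha]

lemma signSum_flipSign (w : ι → ℝ) {s : Finset ι} {a : ι} (ha : a ∉ s) (ε : ι → Bool) :
    signSum w s (flipSign a ε) = signSum w s ε :=
  Finset.sum_congr rfl fun i hi => by
    rw [flipSign_of_ne (by rintro rfl; exact ha hi)]

variable [Fintype ι]

lemma sum_comp_flipSign (a : ι) (f : (ι → Bool) → ℝ) :
    ∑ ε, f (flipSign a ε) = ∑ ε, f ε :=
  Equiv.sum_comp (flipSign_involutive a).toPerm f

/-- Averaging over an independent sign increases `∑ M |T|`. -/
lemma sum_mul_abs_le_of_flipSign (w : ι → ℝ) {s : Finset ι} {a : ι} (ha : a ∉ s)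
    (M : (ι → Bool) → ℝ) (hM : ∀ ε, 0 ≤ M ε) (hMa : ∀ ε, M (flipSign a ε) = M ε) :
    ∑ ε, M ε * |signSum w s ε| ≤ ∑ ε, M ε * |signSum w (insert a s) ε| := by
  have h := sum_comp_flipSign a fun ε => M ε * |signSum w (insert a s) ε|
  -- Pair each `ε` with its flip at `a`: with `x` the new term and `T` the old sum, `|x + T| + |-x +
  -- T| ≥ 2 |T|`, while `M` is the same for both.
  have h2 : ∑ ε, 2 * (M ε * |signSum w s ε|)
      ≤ ∑ ε, (M ε * |signSum w (insert a s) ε|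
        + M (flipSign a ε) * |signSum w (insert a s) (flipSign a ε)|) := by
    refine Finset.sum_le_sum fun ε _ => ?_
    rw [hMa, signSum_insert w ha, signSum_insert w ha, signSum_flipSign w ha, flipSign_self,
      boolSign_not, ← mul_add, mul_left_comm]
    refine mul_le_mul_of_nonneg_left ?_ (hM ε)
    have := abs_add_le (w a * boolSign (ε a) + signSum w s ε)
      (w a * -boolSign (ε a) + signSum w s ε)
    refine le_trans (le_of_eq ?_) this
    rw [show w a * boolSign (ε a) + signSum w s ε + (w a * -boolSign (ε a) + signSum w s ε)
      = 2 * signSum w s ε by ring, abs_mul]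
    norm_num
  rw [Finset.sum_add_distrib, h, ← Finset.mul_sum] at h2
  linarith

lemma sum_signSum_sq (w : ι → ℝ) (s : Finset ι) :
    ∑ ε, signSum w s ε ^ 2 = 2 ^ Fintype.card ι * ∑ i ∈ s, w i ^ 2 := by
  induction s using Finset.induction_on with
  | empty => simp [signSum]
  | insert a s ha ih =>
    have h := sum_comp_flipSign a fun ε => signSum w (insert a s) ε ^ 2
    have h2 : ∑ ε, (signSum w (insert a s) ε ^ 2 + signSum w (insert a s) (flipSign a ε) ^ 2)
        = ∑ ε, (2 * w a ^ 2 + 2 * signSum w s ε ^ 2) := by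
      refine Finset.sum_congr rfl fun ε _ => ?_
      rw [signSum_insert w ha, signSum_insert w ha, signSum_flipSign w ha, flipSign_self,
        boolSign_not]
      linear_combination (2 * w a ^ 2) * boolSign_sq (ε a)
    rw [Finset.sum_add_distrib, Finset.sum_add_distrib, h, ← Finset.mul_sum, ← Finset.mul_sum,
      ih] at h2
    simp only [Finset.sum_const, Finset.card_univ, Fintype.card_fun, Fintype.card_bool,
      nsmul_eq_mul, Nat.cast_pow, Nat.cast_ofNat] at h2
    rw [Finset.sum_insert ha]
    linarith

/-- A dominating process for weighted partial Rademacher sums over initial segments of an ordering,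
with the Azéma–Yor inequality `0 ≤ 𝔼[2 M |T| - M ^ 2]`. -/
lemma exists_dominating_signSum (key w : ι → ℝ) (hw : ∀ i, 0 < w i)
    (hanti : ∀ i j, key i ≤ key j → w j ≤ w i) (s : Finset ι) :
    ∃ M : (ι → Bool) → ℝ, (∀ ε, 0 ≤ M ε) ∧ (∀ a ∉ s, ∀ ε, M (flipSign a ε) = M ε) ∧
      (∀ ε, |signSum w s ε| ≤ M ε) ∧
      (∀ ε v, 0 ≤ v → (∀ i ∈ s, v ≤ w i) → |v * signSum 1 s ε - signSum w s ε| ≤ M ε) ∧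
      (∀ ε v, ∀ U ⊆ s, (∀ i ∈ U, ∀ j ∈ s, key j ≤ key i → j ∈ U) → 0 ≤ v → (∀ i ∈ U, v ≤ w i) →
        |v * signSum 1 U ε| ≤ 2 * M ε) ∧
      0 ≤ ∑ ε, (2 * (M ε * |signSum w s ε|) - M ε ^ 2) := by
  -- Indices enter in order of increasing `key`, hence of decreasing weight; `M` is the running
  -- maximum of the absolute weighted partial sums.
  induction s using Finset.induction_on_max_value key with
  | empty =>
    refine ⟨fun _ => 0, by simp, by simp, by simp [signSum], by simp [signSum], ?_, by simp⟩
    intro ε v U hU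
    rw [Finset.subset_empty.mp hU]
    simp [signSum]
  | insert a s ha hmax ih =>
    obtain ⟨M, h0, hind, hT, hST, hU, hpot⟩ := ih
    refine ⟨fun ε => max (M ε) |signSum w (insert a s) ε|, fun ε => le_max_of_le_left (h0 ε), ?_,
      fun ε => le_max_right _ _, ?_, ?_, ?_⟩
    · intro b hb ε
      simp only [signSum_flipSign w hb, hind b fun h => hb (Finset.mem_insert_of_mem h)]
    · intro ε v hv hvw
      have hva := hvw a (Finset.mem_insert_self a s)
      have h1 : |w a * signSum 1 s ε - signSum w s ε| ≤ max (M ε) |signSum w (insert a s) ε| :=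
        le_max_of_le_left (hST ε (w a) (hw a).le fun i hi => hanti i a (hmax i hi))
      have h2 : |signSum w (insert a s) ε| ≤ max (M ε) |signSum w (insert a s) ε| :=
        le_max_right _ _
      set M' := max (M ε) |signSum w (insert a s) ε|
      have hθ0 : 0 ≤ v / w a := div_nonneg hv (hw a).le
      have hθ1 : v / w a ≤ 1 := (div_le_one (hw a)).mpr hva
      have hwa := (hw a).ne'
      -- Abel summation in inductive form: with `θ = v / w a ∈ [0, 1]` this is a convex combination
      -- of two terms each bounded by the new maximum.
      have hsplit : v * signSum 1 (insert a s) ε - signSum w (insert a s) ε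
          = v / w a * (w a * signSum 1 s ε - signSum w s ε)
            + (1 - v / w a) * (-signSum w (insert a s) ε) := by
        simp only [signSum_insert _ ha, Pi.one_apply]
        field_simp
        ring
      rw [hsplit]
      refine (abs_add_le _ _).trans ?_
      rw [abs_mul, abs_mul, abs_neg, abs_of_nonneg hθ0, abs_of_nonneg (sub_nonneg.mpr hθ1)]
      calc _ ≤ v / w a * M' + (1 - v / w a) * M' := by
            gcongr
        _ = M' := by ring
    · intro ε v U hUs hdown hv hvw
      by_cases haU : a ∈ U
      -- Since `a` has the largest key, an initial segment containing it is everything.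
      · have hUeq : U = insert a s := by
          refine Finset.Subset.antisymm hUs fun j hj => hdown a haU j hj ?_
          rcases Finset.mem_insert.mp hj with rfl | hj
          · exact le_rfl
          · exact hmax j hj
        subst hUeq
        have h1 : |w a * signSum 1 s ε - signSum w s ε| ≤ max (M ε) |signSum w (insert a s) ε| :=
          le_max_of_le_left (hST ε (w a) (hw a).le fun i hi => hanti i a (hmax i hi))
        have h2 : |signSum w (insert a s) ε| ≤ max (M ε) |signSum w (insert a s) ε| :=
          le_max_right _ _
        have hva := hvw a haU
        set M' := max (M ε) |signSum w (insert a s) ε|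
        have hθ0 : 0 ≤ v / w a := div_nonneg hv (hw a).le
        have hθ1 : v / w a ≤ 1 := (div_le_one (hw a)).mpr hva
        have hM' : 0 ≤ M' := le_max_of_le_left (h0 ε)
        have hwa := (hw a).ne'
        have hsplit : v * signSum 1 (insert a s) ε
            = v / w a * ((w a * signSum 1 s ε - signSum w s ε) + signSum w (insert a s) ε) := by
          simp only [signSum_insert _ ha, Pi.one_apply]
          field_simp
          ring
        rw [hsplit, abs_mul, abs_of_nonneg hθ0]
        calc _ ≤ 1 * (M' + M') := by
              gcongr
              exact (abs_add_le _ _).trans (add_le_add h1 h2)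
          _ = 2 * M' := by ring
      · have hUs' : U ⊆ s := fun i hi =>
          (Finset.mem_insert.mp (hUs hi)).resolve_left fun h => haU (h ▸ hi)
        refine (hU ε v U hUs' (fun i hi j hj h => hdown i hi j (Finset.mem_insert_of_mem hj) h)
          hv hvw).trans ?_
        have := le_max_left (M ε) |signSum w (insert a s) ε|
        linarith
    -- The potential `2 M |T| - M²` does not decrease on average when a sign is added with `M`
    -- fixed. Raising `M` to `|T|` when `|T| > M` increases it further, because `m ↦ 2 m |T| - m²`
    -- peaks at `m = |T|`.
    · have h1 := sum_mul_abs_le_of_flipSign w ha M h0 (hind a ha)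
      have h2 : ∑ ε, (2 * (M ε * |signSum w (insert a s) ε|) - M ε ^ 2)
          ≤ ∑ ε, (2 * (max (M ε) |signSum w (insert a s) ε| * |signSum w (insert a s) ε|)
            - max (M ε) |signSum w (insert a s) ε| ^ 2) := by
        refine Finset.sum_le_sum fun ε _ => ?_
        rcases le_total (M ε) |signSum w (insert a s) ε| with h | h
        · rw [max_eq_right h]
          nlinarith [sq_nonneg (M ε - |signSum w (insert a s) ε|)]
        · rw [max_eq_left h]
      refine le_trans ?_ h2
      rw [Finset.sum_sub_distrib, ← Finset.mul_sum] at hpot ⊢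
      linarith

/-- A weighted maximal inequality for Rademacher sums over initial segments: the segment and the
weight may depend on the signs. -/
theorem sum_sq_signSum_le (key w : ι → ℝ) (hw : ∀ i, 0 < w i)
    (hanti : ∀ i j, key i ≤ key j → w j ≤ w i) (s : Finset ι)
    (U : (ι → Bool) → Finset ι) (v : (ι → Bool) → ℝ) (hUs : ∀ ε, U ε ⊆ s)
    (hdown : ∀ ε, ∀ i ∈ U ε, ∀ j ∈ s, key j ≤ key i → j ∈ U ε) (hv : ∀ ε, 0 ≤ v ε)
    (hvw : ∀ ε, ∀ i ∈ U ε, v ε ≤ w i) :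
    ∑ ε, (v ε * signSum 1 (U ε) ε) ^ 2 ≤ 16 * (2 ^ Fintype.card ι * ∑ i ∈ s, w i ^ 2) := by
  obtain ⟨M, h0, -, -, -, hU, hpot⟩ := exists_dominating_signSum key w hw hanti s
  rw [← sum_signSum_sq]
  have h1 : ∑ ε, (v ε * signSum 1 (U ε) ε) ^ 2 ≤ ∑ ε, 4 * M ε ^ 2 := by
    refine Finset.sum_le_sum fun ε _ => ?_
    have := hU ε (v ε) (U ε) (hUs ε) (hdown ε) (hv ε) (hvw ε)
    rw [← sq_abs]
    calc _ ≤ (2 * M ε) ^ 2 := by gcongr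
      _ = 4 * M ε ^ 2 := by ring
  -- From `2 M |T| ≤ M² / 2 + 2 T²` the potential bound becomes Doob's `∑ M² ≤ 4 ∑ T²`. With the
  -- factor `2² = 4` from `h1` this makes the constant 16.
  have h2 : ∑ ε, (2 * (M ε * |signSum w s ε|) - M ε ^ 2)
      ≤ ∑ ε, (2 * signSum w s ε ^ 2 - M ε ^ 2 / 2) := by
    refine Finset.sum_le_sum fun ε _ => ?_
    nlinarith [sq_nonneg (M ε - 2 * |signSum w s ε|), sq_abs (signSum w s ε)]
  rw [Finset.sum_sub_distrib, Finset.sum_sub_distrib, ← Finset.mul_sum, ← Finset.mul_sum,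
    ← Finset.sum_div] at h2
  rw [← Finset.mul_sum] at h1
  rw [Finset.sum_sub_distrib, ← Finset.mul_sum] at hpot
  linarith

end Signs

/-! ### Symmetrization at a data-dependent index. -/

section Symmetrization

variable {ι Ω T : Type*} [Fintype ι] [MeasurableSpace Ω] [MeasurableSpace T]

lemma integrable_of_measurable_of_abs_le {μ : Measure Ω} [IsFiniteMeasure μ] {X : Ω → ℝ}
    (hX : Measurable X) {B : ℝ} (hB : ∀ ω, |X ω| ≤ B) : Integrable X μ :=
  Integrable.of_bound hX.aestronglyMeasurable B (Filter.Eventually.of_forall hB)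

lemma sq_integral_le_integral_sq {μ : Measure Ω} [IsProbabilityMeasure μ] {X : Ω → ℝ}
    (hX : Measurable X) {B : ℝ} (hB : ∀ ω, |X ω| ≤ B) : (∫ ω, X ω ∂μ) ^ 2 ≤ ∫ ω, X ω ^ 2 ∂μ := by
  have h := ProbabilityTheory.variance_eq_sub (μ := μ)
    (MemLp.of_bound (p := 2) hX.aestronglyMeasurable B (Filter.Eventually.of_forall hB))
  have h0 := ProbabilityTheory.variance_nonneg X μ
  simp only [Pi.pow_apply] at h
  linarith

lemma abs_sum_le_card_mul {f : ι → ℝ} {B : ℝ} (h : ∀ i, |f i| ≤ B) :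
    |∑ i, f i| ≤ Fintype.card ι * B := by
  refine (Finset.abs_sum_le_sum_abs _ _).trans ((Finset.sum_le_sum fun i _ => h i).trans ?_)
  simp

/-- Exchange the two entries of the pairs whose sign is negative. -/
def swapPairs (ε : ι → Bool) (z : ι → Ω × Ω) (i : ι) : Ω × Ω :=
  if ε i then z i else (z i).swap

lemma measurePreserving_swapPairs (μ : Measure Ω) [IsProbabilityMeasure μ] (ε : ι → Bool) :
    MeasurePreserving (swapPairs (Ω := Ω) ε) (Measure.pi fun _ => μ.prod μ)
      (Measure.pi fun _ => μ.prod μ) := by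
  refine measurePreserving_pi (fun _ => μ.prod μ) (fun _ => μ.prod μ)
    (f := fun i z => if ε i then z else z.swap) fun i => ?_
  cases ε i
  · simpa using Measure.measurePreserving_swap (μ := μ) (ν := μ)
  · simpa using! MeasurePreserving.id (μ.prod μ)

/-- **Symmetrization** for an empirical process evaluated at a data-dependent index `q`: a bound on
Rademacher averages that holds for every sign-dependent choice of the index bounds the second
moment of the centered process. -/
theorem integral_sq_empirical_le [DecidableEq ι] (μ : Measure Ω) [IsProbabilityMeasure μ]
    (h : Ω → T → ℝ) (hm : Measurable (Function.uncurry h)) {B : ℝ} (hB : ∀ y t, |h y t| ≤ B)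
    (V : Ω → ℝ) (hV : Integrable V μ)
    (hdom : ∀ (y : ι → Ω) (τ : (ι → Bool) → T),
      ∑ ε, (∑ i, h (y i) (τ ε) * boolSign (ε i)) ^ 2 ≤ 2 ^ Fintype.card ι * ∑ i, V (y i))
    (q : (ι → Ω) → T) (hq : Measurable q) :
    ∫ y, (∑ i, (h (y i) (q y) - ∫ z, h z (q y) ∂μ)) ^ 2 ∂(Measure.pi fun _ => μ)
      ≤ 4 * Fintype.card ι * ∫ z, V z ∂μ := by
  set P : Measure (ι → Ω) := Measure.pi fun _ => μ with hP
  set Q : Measure (ι → Ω × Ω) := Measure.pi fun _ => μ.prod μ with hQ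
  let Φ : (ι → Ω) × (ι → Ω) → ℝ := fun w => ∑ i, (h (w.1 i) (q w.1) - h (w.2 i) (q w.1))
  have hmt : ∀ t, Measurable fun z => h z t := fun t => hm.comp measurable_prodMk_right
  have hh : ∀ i, Measurable fun y : ι → Ω => h (y i) (q y) := fun i =>
    hm.comp ((measurable_pi_apply i).prodMk hq)
  have hΦm : Measurable Φ := by
    refine Finset.measurable_sum _ fun i _ => ((hh i).comp measurable_fst).sub ?_
    exact hm.comp (g := Function.uncurry h)
      (f := fun w : (ι → Ω) × (ι → Ω) => (w.2 i, q w.1))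
      (((measurable_pi_apply i).comp measurable_snd).prodMk (hq.comp measurable_fst))
  have hΦB : ∀ w, |Φ w| ≤ Fintype.card ι * (B + B) := fun w =>
    abs_sum_le_card_mul fun i => (abs_sub _ _).trans (add_le_add (hB _ _) (hB _ _))
  have hΦ2B : ∀ w, |Φ w ^ 2| ≤ (Fintype.card ι * (B + B)) ^ 2 := fun w => by
    rw [abs_pow]
    exact pow_le_pow_left₀ (abs_nonneg _) (hΦB w) 2
  have hΦ2 : Integrable (fun w => Φ w ^ 2) (P.prod P) :=
    integrable_of_measurable_of_abs_le (hΦm.pow_const 2) hΦ2B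
  have hmean : ∀ y, ∑ i, (h (y i) (q y) - ∫ z, h z (q y) ∂μ) = ∫ y', Φ (y, y') ∂P := by
    intro y
    have hi : ∀ i, Integrable (fun y' : ι → Ω => h (y' i) (q y)) P := fun i =>
      integrable_of_measurable_of_abs_le ((hmt _).comp (measurable_pi_apply i)) fun _ => hB _ _
    simp only [Φ]
    have hi' : ∀ i, Integrable (fun y' : ι → Ω => h (y i) (q y) - h (y' i) (q y)) P := fun i =>
      (integrable_const _).sub (hi i)
    rw [integral_finsetSum _ fun i _ => hi' i]
    refine Finset.sum_congr rfl fun i _ => ?_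
    rw [integral_sub (integrable_const _) (hi i), integral_const, probReal_univ, one_smul, hP,
      integral_comp_eval (μ := fun _ : ι => μ) (f := fun z => h z (q y))
        (hmt _).aestronglyMeasurable]
  -- Jensen over an independent ghost sample; the index `q` is computed from the first sample only.
  have hstep1 : ∫ y, (∑ i, (h (y i) (q y) - ∫ z, h z (q y) ∂μ)) ^ 2 ∂P
      ≤ ∫ w, Φ w ^ 2 ∂(P.prod P) := by
    rw [integral_prod _ hΦ2]
    refine integral_mono_of_nonneg (Filter.Eventually.of_forall fun y => sq_nonneg _)
      hΦ2.integral_prod_left (Filter.Eventually.of_forall fun y => ?_)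
    simp only [hmean]
    exact sq_integral_le_integral_sq (hΦm.comp measurable_prodMk_left) fun _ => hΦB _
  let F : (ι → Ω × Ω) → ℝ := fun z => Φ (fun i => (z i).1, fun i => (z i).2) ^ 2
  have hFm : Measurable F := by
    refine (hΦm.comp (Measurable.prodMk ?_ ?_)).pow_const 2 <;>
    exact measurable_pi_lambda _ fun i => by fun_prop
  have hstep2 : ∫ w, Φ w ^ 2 ∂(P.prod P) = ∫ z, F z ∂Q :=
    ((measurePreserving_arrowProdEquivProdArrow Ω Ω ι (fun _ => μ) fun _ => μ).integral_comp'
      fun w => Φ w ^ 2).symm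
  have hswap : ∀ ε, ∫ z, F z ∂Q = ∫ z, F (swapPairs ε z) ∂Q := by
    intro ε
    have hmp := measurePreserving_swapPairs μ ε
    conv_lhs => rw [hQ, ← hmp.map_eq]
    exact integral_map hmp.measurable.aemeasurable hFm.aestronglyMeasurable
  have hFint : ∀ ε, Integrable (fun z => F (swapPairs ε z)) Q := fun ε =>
    integrable_of_measurable_of_abs_le (hFm.comp (measurePreserving_swapPairs μ ε).measurable)
      fun _ => hΦ2B _
  have hpt : ∀ z, ∑ ε, F (swapPairs ε z)
      ≤ 2 ^ Fintype.card ι * (2 * ∑ i, (V (z i).1 + V (z i).2)) := by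
    intro z
    -- After swapping, the index depends on the signs; this is why `hdom` must allow every
    -- sign-dependent choice.
    let τ : (ι → Bool) → T := fun ε => q fun i => (swapPairs ε z i).1
    have hF : ∀ ε, F (swapPairs ε z) ≤ 2 * (∑ i, h (z i).1 (τ ε) * boolSign (ε i)) ^ 2
        + 2 * (∑ i, h (z i).2 (τ ε) * boolSign (ε i)) ^ 2 := by
      intro ε
      have : F (swapPairs ε z) = (∑ i, h (z i).1 (τ ε) * boolSign (ε i)
          - ∑ i, h (z i).2 (τ ε) * boolSign (ε i)) ^ 2 := by
        simp only [F, Φ]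
        congr 1
        rw [← Finset.sum_sub_distrib]
        refine Finset.sum_congr rfl fun i _ => ?_
        change h (swapPairs ε z i).1 (τ ε) - h (swapPairs ε z i).2 (τ ε) = _
        unfold swapPairs boolSign
        cases ε i
        · simp
          ring
        · simp
      rw [this]
      nlinarith [sq_nonneg (∑ i, h (z i).1 (τ ε) * boolSign (ε i)
          + ∑ i, h (z i).2 (τ ε) * boolSign (ε i))]
    have h1 := hdom (fun i => (z i).1) τ
    have h2 := hdom (fun i => (z i).2) τ
    refine (Finset.sum_le_sum fun ε _ => hF ε).trans ?_
    rw [Finset.sum_add_distrib, ← Finset.mul_sum, ← Finset.mul_sum, Finset.sum_add_distrib]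
    linarith
  have hV1 : ∀ i, Integrable (fun z : ι → Ω × Ω => V (z i).1) Q := fun i =>
    integrable_comp_eval (μ := fun _ : ι => μ.prod μ) (f := fun p => V p.1) (hV.comp_fst μ)
  have hV2 : ∀ i, Integrable (fun z : ι → Ω × Ω => V (z i).2) Q := fun i =>
    integrable_comp_eval (μ := fun _ : ι => μ.prod μ) (f := fun p => V p.2) (hV.comp_snd μ)
  have hV12 : ∀ i, Integrable (fun z : ι → Ω × Ω => V (z i).1 + V (z i).2) Q := fun i =>
    (hV1 i).add (hV2 i)
  have hVi : ∀ i, ∫ z : ι → Ω × Ω, (V (z i).1 + V (z i).2) ∂Q = 2 * ∫ y, V y ∂μ := by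
    intro i
    rw [integral_add (hV1 i) (hV2 i), hQ,
      integral_comp_eval (μ := fun _ : ι => μ.prod μ) (f := fun p => V p.1)
        (hV.comp_fst μ).aestronglyMeasurable,
      integral_comp_eval (μ := fun _ : ι => μ.prod μ) (f := fun p => V p.2)
        (hV.comp_snd μ).aestronglyMeasurable, integral_fun_fst, integral_fun_snd]
    simp
    ring
  have hint : 2 ^ Fintype.card ι * ∫ z, F z ∂Q
      ≤ 2 ^ Fintype.card ι * (4 * Fintype.card ι * ∫ z, V z ∂μ) := by
    calc 2 ^ Fintype.card ι * ∫ z, F z ∂Q = ∑ ε : ι → Bool, ∫ z, F (swapPairs ε z) ∂Q := by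
          simp [← hswap]
      _ = ∫ z, ∑ ε : ι → Bool, F (swapPairs ε z) ∂Q :=
          (integral_finsetSum _ fun ε _ => hFint ε).symm
      _ ≤ ∫ z, 2 ^ Fintype.card ι * (2 * ∑ i, (V (z i).1 + V (z i).2)) ∂Q :=
          integral_mono (integrable_finsetSum _ fun ε _ => hFint ε)
            (((integrable_finsetSum _ fun i _ => hV12 i).const_mul 2).const_mul _) hpt
      _ = _ := by
          rw [integral_const_mul, integral_const_mul,
            integral_finsetSum _ fun i _ => hV12 i, Finset.sum_congr rfl
              fun i _ => hVi i, Finset.sum_const, Finset.card_univ, nsmul_eq_mul]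
          ring
  exact hstep1.trans (hstep2.le.trans (le_of_mul_le_mul_left hint (by positivity)))

end Symmetrization

/-! ### Bounded density and quadratic drop of the revenue. -/

section Density

/-- A Lipschitz density on `[0, 1]` extends to a globally Lipschitz one. -/
lemma exists_lipschitz_density {μ : Measure ℝ} {f : ℝ → ℝ} {L : ℝ} (hL : 0 ≤ L)
    (hf : IsDensity μ f)
    (hlip : ∀ y ∈ Set.Icc (0 : ℝ) 1, ∀ y' ∈ Set.Icc (0 : ℝ) 1, |f y - f y'| ≤ L * |y - y'|) :
    ∃ g : ℝ → ℝ, LipschitzWith L.toNNReal g ∧ (∀ y, 0 ≤ g y) ∧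
      (∀ y ∈ Set.Icc (0 : ℝ) 1, g y = f y) ∧ IsDensity μ g := by
  have hg : ∀ y ∈ Set.Icc (0 : ℝ) 1, f (Set.projIcc 0 1 zero_le_one y) = f y := fun y hy => by
    rw [Set.projIcc_of_mem _ hy]
  refine ⟨fun y => f (Set.projIcc 0 1 zero_le_one y), ?_, fun y => hf.nonneg _ (Subtype.prop _),
    hg, fun y _ => hf.nonneg _ (Subtype.prop _), ?_⟩
  · refine LipschitzWith.of_dist_le_mul fun x y => ?_
    rw [Real.dist_eq, Real.dist_eq, Real.coe_toNNReal _ hL]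
    refine (hlip _ (Subtype.prop _) _ (Subtype.prop _)).trans ?_
    exact mul_le_mul_of_nonneg_left (Set.abs_projIcc_sub_projIcc _) hL
  · rw [hf.eq_withDensity]
    refine withDensity_congr_ae ?_
    filter_upwards [ae_restrict_mem measurableSet_Icc] with y hy
    rw [hg y hy]

variable {μ : Measure ℝ} {g : ℝ → ℝ}

lemma le_smul_volume (hg : IsDensity μ g) {K : ℝ} (hK : ∀ y ∈ Set.Icc (0 : ℝ) 1, g y ≤ K) :
    μ ≤ ENNReal.ofReal K • (volume : Measure ℝ) := by
  rw [hg.eq_withDensity]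
  calc (volume.restrict (Set.Icc (0 : ℝ) 1)).withDensity (fun y => ENNReal.ofReal (g y))
      ≤ (volume.restrict (Set.Icc (0 : ℝ) 1)).withDensity (fun _ => ENNReal.ofReal K) := by
        refine withDensity_mono ?_
        filter_upwards [ae_restrict_mem measurableSet_Icc] with y hy
        exact ENNReal.ofReal_le_ofReal (hK y hy)
    _ = ENNReal.ofReal K • volume.restrict (Set.Icc (0 : ℝ) 1) := withDensity_const _
    _ ≤ _ := by
        gcongr
        exact Measure.restrict_le_self

variable [IsProbabilityMeasure μ]

lemma cdf_eq_integral_density (hg : IsDensity μ g) (hc : Continuous g) (h0 : ∀ y, 0 ≤ g y)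
    {p : ℝ} (hp : p ∈ Set.Icc (0 : ℝ) 1) : ProbabilityTheory.cdf μ p = ∫ x in 0..p, g x := by
  have hset : Set.Iic p ∩ Set.Icc 0 1 = Set.Icc 0 p := by
    ext x
    simp only [Set.mem_inter_iff, Set.mem_Iic, Set.mem_Icc]
    exact ⟨fun h => ⟨h.2.1, h.1⟩, fun h => ⟨h.2, h.1, h.2.trans hp.2⟩⟩
  rw [ProbabilityTheory.cdf_eq_real, Measure.real, hg.eq_withDensity,
    withDensity_apply _ measurableSet_Iic, Measure.restrict_restrict measurableSet_Iic, hset,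
    intervalIntegral.integral_of_le hp.1, ← integral_Icc_eq_integral_Ioc,
    integral_eq_lintegral_of_nonneg_ae (Filter.Eventually.of_forall h0)
      hc.aestronglyMeasurable]

/-- A Lipschitz density stays above `g y - L` on the unit interval, so a larger value of `g y` would
give total mass above 1. -/
lemma density_le (hg : IsDensity μ g) {L : ℝ} (hL : 0 ≤ L) (hlip : LipschitzWith L.toNNReal g)
    (h0 : ∀ y, 0 ≤ g y) {y : ℝ} (hy : y ∈ Set.Icc (0 : ℝ) 1) : g y ≤ 1 + L := by
  have h1 := cdf_eq_integral_density hg hlip.continuous h0 (p := 1) (by simp)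
  have h2 : ∫ x in (0 : ℝ)..1, (g y - L) ≤ ∫ x in (0 : ℝ)..1, g x := by
    refine intervalIntegral.integral_mono_on zero_le_one (by simp)
      (hlip.continuous.intervalIntegrable _ _) fun x hx => ?_
    have h3 := hlip.dist_le_mul y x
    rw [Real.dist_eq, Real.dist_eq, Real.coe_toNNReal _ hL] at h3
    have h4 : |y - x| ≤ 1 := abs_le.mpr ⟨by linarith [hy.1, hx.2], by linarith [hy.2, hx.1]⟩
    have h5 := mul_le_mul_of_nonneg_left h4 hL
    linarith [le_abs_self (g y - g x)]
  have h3 := ProbabilityTheory.cdf_le_one μ 1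
  simp at h2
  linarith

lemma hasDerivAt_revenue_integral (hc : Continuous g) (p : ℝ) :
    HasDerivAt (fun p => p * (1 - ∫ x in 0..p, g x)) (1 - (∫ x in 0..p, g x) - p * g p) p := by
  refine ((hasDerivAt_id' p).fun_mul
    ((hc.integral_hasStrictDerivAt 0 p).hasDerivAt.const_sub 1)).congr_deriv ?_
  ring

/-- The curvature bound holds only almost everywhere, but the marginal revenue is absolutely
continuous because `g` is Lipschitz, so its derivative can be integrated. -/
lemma marginalRevenue_sub_le {L c : ℝ} (hlip : LipschitzWith L.toNNReal g)
    (hd : ∀ᵐ y ∂(volume.restrict (Set.Icc (0 : ℝ) 1)), -2 * g y - y * deriv g y ≤ -c)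
    {a b : ℝ} (ha : 0 ≤ a) (hab : a ≤ b) (hb : b ≤ 1) :
    (1 - (∫ x in 0..b, g x) - b * g b) - (1 - (∫ x in 0..a, g x) - a * g a) ≤ -c * (b - a) := by
  set γ : ℝ → ℝ := fun p => (1 - ∫ x in 0..p, g x) - p * g p with hγ
  have hc := hlip.continuous
  have hint : ∀ p, HasDerivAt (fun p => 1 - ∫ x in 0..p, g x) (-g p) p := fun p =>
    (hc.integral_hasStrictDerivAt 0 p).hasDerivAt.const_sub 1
  have hgac : AbsolutelyContinuousOnInterval g a b :=
    (hlip.lipschitzOnWith (s := Set.uIcc a b)).absolutelyContinuousOnInterval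
  have hac : AbsolutelyContinuousOnInterval γ a b := by
    refine AbsolutelyContinuousOnInterval.sub ?_ (AbsolutelyContinuousOnInterval.mul ?_ hgac)
    · refine ContDiffOn.absolutelyContinuousOnInterval (ContDiff.contDiffOn ?_)
      refine contDiff_one_iff_deriv.mpr ⟨fun p => (hint p).differentiableAt, ?_⟩
      rw [funext fun p => (hint p).deriv]
      exact hc.neg
    · exact (LipschitzWith.id.lipschitzOnWith (s := Set.uIcc a b)).absolutelyContinuousOnInterval
  have hle : ∫ x in a..b, deriv γ x ≤ ∫ x in a..b, -c := by
    refine intervalIntegral.integral_mono_ae_restrict hab hac.intervalIntegrable_deriv (by simp) ?_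
    have hd' := ae_restrict_of_ae_restrict_of_subset (Set.Icc_subset_Icc ha hb) hd
    filter_upwards [hd', ae_restrict_of_ae hlip.ae_differentiableAt] with x hx hdx
    have : HasDerivAt γ (-g x - (1 * g x + x * deriv g x)) x :=
      (hint x).sub ((hasDerivAt_id x).mul hdx.hasDerivAt)
    rw [this.deriv]
    linarith
  rw [hac.integral_deriv_eq_sub] at hle
  simp only [intervalIntegral.integral_const, smul_eq_mul] at hle
  change γ b - γ a ≤ _
  linarith

/-- The revenue drops at least quadratically away from an interior maximizer. -/
lemma revenue_quadratic_drop {L c : ℝ} (hg : IsDensity μ g) (hlip : LipschitzWith L.toNNReal g)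
    (h0 : ∀ y, 0 ≤ g y)
    (hd : ∀ᵐ y ∂(volume.restrict (Set.Icc (0 : ℝ) 1)), -2 * g y - y * deriv g y ≤ -c)
    {p₀ : ℝ} (hp₀ : p₀ ∈ Set.Ioo (0 : ℝ) 1) (hmax : IsMaxOn (revenue μ) (Set.Icc 0 1) p₀)
    {p : ℝ} (hp : p ∈ Set.Icc (0 : ℝ) 1) :
    c / 2 * (p - p₀) ^ 2 ≤ revenue μ p₀ - revenue μ p := by
  set G : ℝ → ℝ := fun p => p * (1 - ∫ x in 0..p, g x) with hG
  have hrev : ∀ p ∈ Set.Icc (0 : ℝ) 1, revenue μ p = G p := fun p hp => by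
    rw [revenue, cdf_eq_integral_density hg hlip.continuous h0 hp]
  have hGd := hasDerivAt_revenue_integral hlip.continuous
  have hp₀' := Set.Ioo_subset_Icc_self hp₀
  have hloc : IsLocalMax G p₀ := by
    filter_upwards [Ioo_mem_nhds hp₀.1 hp₀.2] with x hx
    rw [← hrev x (Set.Ioo_subset_Icc_self hx), ← hrev p₀ hp₀']
    exact hmax (Set.Ioo_subset_Icc_self hx)
  have hzero := hloc.hasDerivAt_eq_zero (hGd p₀)
  -- The marginal revenue vanishes at `p₀` and decreases at rate at least `c`, so even with the
  -- parabola added, the function rises before `p₀` and falls after it.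
  have hψ : ∀ x, HasDerivAt (fun x => G x + c / 2 * (x - p₀) ^ 2)
      ((1 - (∫ t in 0..x, g t) - x * g x) + c * (x - p₀)) x := by
    intro x
    refine ((hGd x).fun_add
      ((((hasDerivAt_id' x).sub_const p₀).fun_pow 2).const_mul (c / 2))).congr_deriv ?_
    push_cast
    ring
  have hcont : Continuous fun x => G x + c / 2 * (x - p₀) ^ 2 :=
    continuous_iff_continuousAt.mpr fun x => (hψ x).continuousAt
  rw [hrev p hp, hrev p₀ hp₀']
  rcases le_total p₀ p with hle | hle
  · have hanti : AntitoneOn (fun x => G x + c / 2 * (x - p₀) ^ 2) (Set.Icc p₀ 1) := by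
      refine antitoneOn_of_deriv_nonpos (convex_Icc _ _) hcont.continuousOn
        (fun x _ => (hψ x).differentiableAt.differentiableWithinAt) fun x hx => ?_
      rw [interior_Icc] at hx
      rw [(hψ x).deriv]
      have := marginalRevenue_sub_le hlip hd hp₀.1.le hx.1.le hx.2.le
      linarith
    have := hanti ⟨le_rfl, hp₀.2.le⟩ ⟨hle, hp.2⟩ hle
    simp only [sub_self] at this
    linarith
  · have hmono : MonotoneOn (fun x => G x + c / 2 * (x - p₀) ^ 2) (Set.Icc 0 p₀) := by
      refine monotoneOn_of_deriv_nonneg (convex_Icc _ _) hcont.continuousOn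
        (fun x _ => (hψ x).differentiableAt.differentiableWithinAt) fun x hx => ?_
      rw [interior_Icc] at hx
      rw [(hψ x).deriv]
      have := marginalRevenue_sub_le hlip hd hx.1.le hx.2.le hp₀.2.le
      linarith
    have := hmono ⟨hp.1, hle⟩ ⟨hp₀.1.le, le_rfl⟩ hle
    simp only [sub_self] at this
    linarith

end Density

/-- The facts about a law of the class `marginalClass` that the regret bound uses. -/
theorem exists_quadratic_drop_of_mem_marginalClass {C₀ Cs Cb : ℝ} (hC₀ : 0 ≤ C₀) {μ : Measure ℝ}
    (hμ : μ ∈ marginalClass C₀ Cs Cb) :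
    μ ≤ ENNReal.ofReal (1 + C₀) • (volume : Measure ℝ) ∧ μ (Set.Icc 0 1)ᶜ = 0 ∧
      ∃ p₀ ∈ Set.Icc (0 : ℝ) 1, optRevenue μ = revenue μ p₀ ∧
        ∀ p ∈ Set.Icc (0 : ℝ) 1, Cs / 2 * (p - p₀) ^ 2 ≤ revenue μ p₀ - revenue μ p := by
  obtain ⟨hprob, f, hf, hlip, -, hd, -, p₀, hp₀, hmax, -⟩ := hμ
  obtain ⟨g, hglip, hg0, hgf, hg⟩ := exists_lipschitz_density hC₀ hf hlip
  have hp₀' := Set.Ioo_subset_Icc_self hp₀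
  refine ⟨le_smul_volume hg fun y hy => density_le hg hC₀ hglip hg0 hy, ?_, p₀, hp₀', ?_, ?_⟩
  · rw [hf.eq_withDensity]
    refine withDensity_absolutelyContinuous _ _ ?_
    rw [Measure.restrict_apply measurableSet_Icc.compl]
    simp
  · refine IsGreatest.csSup_eq ⟨⟨p₀, hp₀', rfl⟩, ?_⟩
    rintro _ ⟨p, hp, rfl⟩
    exact hmax hp
  · intro p hp
    refine revenue_quadratic_drop hg hglip hg0 ?_ hp₀ hmax hp
    -- `deriv` is two-sided and `f` is arbitrary outside the interval, so the derivatives of `f` and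
    -- its extension `g` are compared only at interior points.
    rw [← restrict_Ioo_eq_restrict_Icc] at hd ⊢
    filter_upwards [hd, ae_restrict_mem measurableSet_Ioo] with y hy hmem
    have heq : g =ᶠ[nhds y] f := by
      filter_upwards [Ioo_mem_nhds hmem.1 hmem.2] with x hx
      exact hgf x (Set.Ioo_subset_Icc_self hx)
    rw [heq.deriv_eq, heq.eq_of_nhds]
    exact hy

/-! ### Localized regret bound. -/

section Regret

/-- The distance to `p₀`, smoothed at scale `δ`. -/
noncomputable def smoothDist (p₀ δ t : ℝ) : ℝ := √((t - p₀) ^ 2 + δ ^ 2)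

lemma smoothDist_sq (p₀ δ t : ℝ) : smoothDist p₀ δ t ^ 2 = (t - p₀) ^ 2 + δ ^ 2 :=
  Real.sq_sqrt (by positivity)

lemma smoothDist_pos (p₀ : ℝ) {δ : ℝ} (hδ : 0 < δ) (t : ℝ) : 0 < smoothDist p₀ δ t :=
  Real.sqrt_pos.mpr (by positivity)

lemma le_smoothDist (p₀ δ t : ℝ) : δ ≤ smoothDist p₀ δ t :=
  Real.le_sqrt_of_sq_le (by nlinarith [sq_nonneg (t - p₀)])

lemma smoothDist_mono {p₀ δ s t : ℝ} (h : |s - p₀| ≤ |t - p₀|) :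
    smoothDist p₀ δ s ≤ smoothDist p₀ δ t :=
  Real.sqrt_le_sqrt (add_le_add_left (sq_le_sq.mpr h) _)

lemma inv_smoothDist_anti {p₀ δ s t : ℝ} (hδ : 0 < δ) (h : |s - p₀| ≤ |t - p₀|) :
    (smoothDist p₀ δ t)⁻¹ ≤ (smoothDist p₀ δ s)⁻¹ :=
  inv_anti₀ (smoothDist_pos p₀ hδ s) (smoothDist_mono h)

lemma measurable_smoothDist (p₀ δ : ℝ) : Measurable (smoothDist p₀ δ) := by
  unfold smoothDist
  fun_prop

lemma inv_smoothDist_sq_eq (p₀ : ℝ) {δ : ℝ} (hδ : 0 < δ) (y : ℝ) :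
    (smoothDist p₀ δ y)⁻¹ ^ 2 = (δ ^ 2)⁻¹ * (1 + ((y - p₀) / δ) ^ 2)⁻¹ := by
  rw [inv_pow, smoothDist_sq, ← mul_inv]
  congr 1
  field_simp
  ring

lemma integrable_inv_smoothDist_sq (p₀ : ℝ) {δ : ℝ} (hδ : 0 < δ) :
    Integrable (fun y => (smoothDist p₀ δ y)⁻¹ ^ 2) := by
  simp only [inv_smoothDist_sq_eq p₀ hδ]
  exact ((integrable_inv_one_add_sq.comp_div hδ.ne').comp_sub_right p₀).const_mul _

lemma integral_inv_smoothDist_sq (p₀ : ℝ) {δ : ℝ} (hδ : 0 < δ) :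
    ∫ y, (smoothDist p₀ δ y)⁻¹ ^ 2 = Real.pi / δ := by
  simp only [inv_smoothDist_sq_eq p₀ hδ]
  rw [integral_const_mul, integral_sub_right_eq_self (fun y => (1 + (y / δ) ^ 2)⁻¹) p₀,
    Measure.integral_comp_div (fun y : ℝ => (1 + y ^ 2)⁻¹) δ, integral_univ_inv_one_add_sq,
    abs_of_pos hδ, smul_eq_mul]
  field_simp

lemma integral_inv_smoothDist_sq_le {μ : Measure ℝ} {K : ℝ} (hK : 0 ≤ K)
    (hμ : μ ≤ ENNReal.ofReal K • (volume : Measure ℝ)) (p₀ : ℝ) {δ : ℝ} (hδ : 0 < δ) :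
    ∫ y, (smoothDist p₀ δ y)⁻¹ ^ 2 ∂μ ≤ K * (Real.pi / δ) := by
  refine (integral_mono_measure hμ (Filter.Eventually.of_forall fun y => sq_nonneg _)
    ((integrable_inv_smoothDist_sq p₀ hδ).smul_measure ENNReal.ofReal_ne_top)).trans ?_
  rw [integral_smul_measure, integral_inv_smoothDist_sq p₀ hδ, ENNReal.toReal_ofReal hK,
    smul_eq_mul]

/-- The difference between the revenues of the prices `t` and `p₀` from a buyer with valuation
`y`. -/
noncomputable def saleDiff (p₀ y t : ℝ) : ℝ :=
  (if t ≤ y then t else 0) - if p₀ ≤ y then p₀ else 0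

lemma measurable_saleDiff (p₀ : ℝ) : Measurable fun x : ℝ × ℝ => saleDiff p₀ x.1 x.2 := by
  refine (Measurable.ite (measurableSet_le measurable_snd measurable_fst) measurable_snd
    measurable_const).sub (Measurable.ite (measurableSet_le measurable_const measurable_fst)
    measurable_const measurable_const)

lemma abs_saleDiff_le {p₀ t : ℝ} (hp₀ : p₀ ∈ Set.Icc (0 : ℝ) 1) (ht : t ∈ Set.Icc (0 : ℝ) 1)
    (y : ℝ) : |saleDiff p₀ y t| ≤ 1 := by
  obtain ⟨h1, h2⟩ := hp₀
  obtain ⟨h3, h4⟩ := ht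
  unfold saleDiff
  rw [abs_le]
  split_ifs <;> constructor <;> linarith

/-- Isolates the dependence on `t`: the index sets that move with `t` lie between `p₀` and `t`, and
the remaining set is fixed with a coefficient small near `p₀`. -/
lemma sum_saleDiff_mul_boolSign {ι : Type*} [Fintype ι] [DecidableEq ι] (p₀ t : ℝ) (y : ι → ℝ)
    (ε : ι → Bool) :
    ∑ i, saleDiff p₀ (y i) t * boolSign (ε i)
      = t * signSum 1 {i | t ≤ y i ∧ y i < p₀} ε - t * signSum 1 {i | p₀ ≤ y i ∧ y i < t} ε
        + (t - p₀) * signSum 1 {i | p₀ ≤ y i} ε := by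
  simp only [signSum, Finset.mul_sum, Finset.sum_filter]
  rw [← Finset.sum_sub_distrib, ← Finset.sum_add_distrib]
  refine Finset.sum_congr rfl fun i _ => ?_
  simp only [saleDiff, Pi.one_apply]
  by_cases h1 : t ≤ y i <;> by_cases h2 : p₀ ≤ y i <;>
    simp [h1, h2, not_lt.mpr, not_le.mp]; ring

/-- Rademacher bound for the normalized revenue differences at sign-dependent prices. -/
lemma sum_sq_saleDiff_le {ι : Type*} [Fintype ι] [DecidableEq ι] (p₀ : ℝ) {δ : ℝ} (hδ : 0 < δ)
    (y : ι → ℝ) (τ : (ι → Bool) → Set.Icc (0 : ℝ) 1) :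
    ∑ ε, (∑ i, saleDiff p₀ (y i) (τ ε) / smoothDist p₀ δ (τ ε) * boolSign (ε i)) ^ 2
      ≤ 2 ^ Fintype.card ι * ∑ i, (96 * (smoothDist p₀ δ (y i))⁻¹ ^ 2 + 3) := by
  set w : ι → ℝ := fun i => (smoothDist p₀ δ (y i))⁻¹ with hw
  have hw0 : ∀ i, 0 < w i := fun i => inv_pos.mpr (smoothDist_pos _ hδ _)
  let key : ι → ℝ := fun i => |y i - p₀|
  have hanti : ∀ i j, key i ≤ key j → w j ≤ w i := fun i j h => inv_smoothDist_anti hδ h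
  let v : (ι → Bool) → ℝ := fun ε => (smoothDist p₀ δ (τ ε))⁻¹
  have hv0 : ∀ ε, 0 ≤ v ε := fun ε => (inv_pos.mpr (smoothDist_pos _ hδ _)).le
  have hsub : ∀ s : Finset ι, ∑ i ∈ s, w i ^ 2 ≤ ∑ i, w i ^ 2 := fun s =>
    Finset.sum_le_univ_sum_of_nonneg fun i => sq_nonneg _
  -- On each side of `p₀` the moving set is an initial segment for the distance to `p₀`, and its
  -- members are no farther from `p₀` than the price, so their weights dominate `v ε`.
  have hright : ∑ ε, (v ε * signSum 1 {i | p₀ ≤ y i ∧ y i < τ ε} ε) ^ 2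
      ≤ 16 * (2 ^ Fintype.card ι * ∑ i, w i ^ 2) := by
    refine (sum_sq_signSum_le key w hw0 hanti {i | p₀ ≤ y i} _ v (fun ε i hi => ?_)
      (fun ε i hi j hj hji => ?_) hv0 (fun ε i hi => ?_)).trans
      (mul_le_mul_of_nonneg_left (mul_le_mul_of_nonneg_left (hsub _) (by positivity))
        (by norm_num))
    all_goals simp only [Finset.mem_filter, Finset.mem_univ, true_and] at *
    · exact hi.1
    · refine ⟨hj, ?_⟩
      simp only [key, abs_of_nonneg (sub_nonneg.mpr hj), abs_of_nonneg (sub_nonneg.mpr hi.1)] at hji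
      linarith
    · refine inv_smoothDist_anti hδ ?_
      rw [abs_of_nonneg (sub_nonneg.mpr hi.1), abs_of_nonneg (by linarith)]
      linarith
  have hleft : ∑ ε, (v ε * signSum 1 {i | τ ε ≤ y i ∧ y i < p₀} ε) ^ 2
      ≤ 16 * (2 ^ Fintype.card ι * ∑ i, w i ^ 2) := by
    refine (sum_sq_signSum_le key w hw0 hanti {i | y i < p₀} _ v (fun ε i hi => ?_)
      (fun ε i hi j hj hji => ?_) hv0 (fun ε i hi => ?_)).trans
      (mul_le_mul_of_nonneg_left (mul_le_mul_of_nonneg_left (hsub _) (by positivity))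
        (by norm_num))
    all_goals simp only [Finset.mem_filter, Finset.mem_univ, true_and] at *
    · exact hi.2
    · refine ⟨?_, hj⟩
      simp only [key, abs_of_neg (sub_neg.mpr hj), abs_of_neg (sub_neg.mpr hi.2)] at hji
      linarith
    · refine inv_smoothDist_anti hδ ?_
      rw [abs_of_neg (sub_neg.mpr hi.2), abs_of_neg (by linarith)]
      linarith
  have hfix : ∑ ε : ι → Bool, signSum 1 {i | p₀ ≤ y i} ε ^ 2
      ≤ 2 ^ Fintype.card ι * ∑ i : ι, (1 : ℝ) := by
    rw [sum_signSum_sq]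
    refine mul_le_mul_of_nonneg_left ?_ (by positivity)
    simp only [Pi.one_apply, one_pow]
    exact Finset.sum_le_univ_sum_of_nonneg fun i => zero_le_one
  -- Squaring three terms costs a factor 3; with the two maximal inequalities this gives `96 = 3 *
  -- (16 + 16)`, and the fixed set gives the 3.
  have hpt : ∀ ε, (∑ i, saleDiff p₀ (y i) (τ ε) / smoothDist p₀ δ (τ ε) * boolSign (ε i)) ^ 2
      ≤ 3 * (v ε * signSum 1 {i | τ ε ≤ y i ∧ y i < p₀} ε) ^ 2
        + 3 * (v ε * signSum 1 {i | p₀ ≤ y i ∧ y i < τ ε} ε) ^ 2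
        + 3 * signSum 1 {i | p₀ ≤ y i} ε ^ 2 := by
    intro ε
    obtain ⟨ht0, ht1⟩ := (τ ε).2
    have hsum : ∑ i, saleDiff p₀ (y i) (τ ε) / smoothDist p₀ δ (τ ε) * boolSign (ε i)
        = v ε * ∑ i, saleDiff p₀ (y i) (τ ε) * boolSign (ε i) := by
      rw [Finset.mul_sum]
      refine Finset.sum_congr rfl fun i _ => ?_
      simp only [v]
      ring
    rw [hsum, sum_saleDiff_mul_boolSign]
    set a := signSum 1 {i | τ ε ≤ y i ∧ y i < p₀} ε
    set b := signSum 1 {i | p₀ ≤ y i ∧ y i < τ ε} ε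
    set d := signSum 1 {i | p₀ ≤ y i} ε
    set t : ℝ := (τ ε : ℝ)
    have hvt : (v ε * (t - p₀)) ^ 2 ≤ 1 := by
      have hD := smoothDist_pos p₀ hδ t
      have : (v ε * (t - p₀)) ^ 2 = (t - p₀) ^ 2 / smoothDist p₀ δ t ^ 2 := by
        change ((smoothDist p₀ δ t)⁻¹ * (t - p₀)) ^ 2 = _
        rw [mul_pow, inv_pow, inv_mul_eq_div]
      rw [this, div_le_one (by positivity), smoothDist_sq]
      nlinarith [sq_nonneg δ]
    have ht2 : t ^ 2 ≤ 1 := pow_le_one₀ ht0 ht1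
    have h1 : (t * (v ε * a)) ^ 2 ≤ (v ε * a) ^ 2 := by
      rw [mul_pow]
      exact mul_le_of_le_one_left (sq_nonneg _) ht2
    have h2 : (t * (v ε * b)) ^ 2 ≤ (v ε * b) ^ 2 := by
      rw [mul_pow]
      exact mul_le_of_le_one_left (sq_nonneg _) ht2
    have h3 : (v ε * (t - p₀) * d) ^ 2 ≤ d ^ 2 := by
      rw [mul_pow]
      exact mul_le_of_le_one_left (sq_nonneg _) hvt
    have h4 : ∀ x z u : ℝ, (x - z + u) ^ 2 ≤ 3 * x ^ 2 + 3 * z ^ 2 + 3 * u ^ 2 := fun x z u => by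
      nlinarith [sq_nonneg (x + z), sq_nonneg (x - u), sq_nonneg (z + u)]
    calc (v ε * (t * a - t * b + (t - p₀) * d)) ^ 2
        = (t * (v ε * a) - t * (v ε * b) + v ε * (t - p₀) * d) ^ 2 := by ring
      _ ≤ _ := by
        refine (h4 _ _ _).trans ?_
        linarith
  refine (Finset.sum_le_sum fun ε _ => hpt ε).trans ?_
  rw [Finset.sum_add_distrib, Finset.sum_add_distrib, ← Finset.mul_sum, ← Finset.mul_sum,
    ← Finset.mul_sum, Finset.sum_add_distrib, ← Finset.mul_sum]
  have h3 : ∑ i : ι, (3 : ℝ) = 3 * ∑ i : ι, (1 : ℝ) := by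
    rw [Finset.mul_sum]
    simp
  rw [h3]
  linarith

variable {μ : Measure ℝ} [IsProbabilityMeasure μ]

/-- Without atoms, it is immaterial whether a buyer whose valuation equals the price buys. -/
lemma revenue_eq_mul_measureReal_Ici [NullSingletonClass μ] (p : ℝ) :
    revenue μ p = p * μ.real (Set.Ici p) := by
  rw [revenue, ProbabilityTheory.cdf_eq_real, ← probReal_compl_eq_one_sub measurableSet_Iic,
    Set.compl_Iic, measureReal_congr Ioi_ae_eq_Ici]

lemma integral_saleDiff [NullSingletonClass μ] (p₀ t : ℝ) :
    ∫ y, saleDiff p₀ y t ∂μ = revenue μ t - revenue μ p₀ := by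
  have h : ∀ s : ℝ, (fun y : ℝ => if s ≤ y then s else 0) = (Set.Ici s).indicator fun _ => s := by
    intro s
    ext y
    simp [Set.indicator]
  have hi : ∀ s : ℝ, Integrable ((Set.Ici s).indicator fun _ => s) μ := fun s =>
    (integrable_const s).indicator measurableSet_Ici
  have heval : ∀ s : ℝ, ∫ y, (Set.Ici s).indicator (fun _ => s) y ∂μ = revenue μ s := by
    intro s
    rw [integral_indicator_const _ measurableSet_Ici, revenue_eq_mul_measureReal_Ici, smul_eq_mul,
      mul_comm]
  simp only [saleDiff]
  rw [integral_sub (by rw [h]; exact hi t) (by rw [h]; exact hi p₀), h, h, heval, heval]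

lemma measurable_revenue (μ : Measure ℝ) : Measurable (revenue μ) :=
  measurable_id.mul (measurable_const.sub (ProbabilityTheory.monotone_cdf μ).measurable)

lemma empRevenue_eq_sum {n : ℕ} (y : Fin n → ℝ) (p : ℝ) :
    empRevenue y p = (∑ i, if p ≤ y i then p else 0) / n := by
  rw [empRevenue, ← Finset.sum_filter, Finset.sum_const, nsmul_eq_mul]
  ring

lemma sum_saleDiff_nonneg {n : ℕ} (hn : 1 ≤ n) {y : Fin n → ℝ} {p p₀ : ℝ} (hp : IsERMPrice y p)
    (hp₀ : p₀ ∈ Set.Icc (0 : ℝ) 1) : 0 ≤ ∑ i, saleDiff p₀ (y i) p := by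
  have hn0 : (0 : ℝ) < n := by exact_mod_cast hn
  have h : empRevenue y p₀ ≤ empRevenue y p := hp.2 hp₀
  rw [empRevenue_eq_sum, empRevenue_eq_sum, div_le_div_iff_of_pos_right hn0] at h
  simp only [saleDiff]
  rw [Finset.sum_sub_distrib]
  linarith

lemma ae_pi_mem_Icc (hsupp : μ (Set.Icc 0 1)ᶜ = 0) (n : ℕ) :
    ∀ᵐ y ∂(Measure.pi fun _ : Fin n => μ), ∀ i, y i ∈ Set.Icc (0 : ℝ) 1 := by
  refine Filter.eventually_all.mpr fun i => ?_
  exact (Measure.tendsto_eval_ae_ae (μ := fun _ : Fin n => μ)).eventually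
    (measure_eq_zero_iff_ae_notMem.mp hsupp |>.mono fun y hy => by simpa using hy)

/-- Regret bound for empirical revenue maximization under a quadratic drop of the revenue, at an
arbitrary localization scale `δ`. -/
theorem regret_le {K c p₀ δ : ℝ} (hK : 0 ≤ K) (hc : 0 < c) (hδ : 0 < δ)
    (hp₀ : p₀ ∈ Set.Icc (0 : ℝ) 1)
    (hμ : μ ≤ ENNReal.ofReal K • (volume : Measure ℝ)) (hsupp : μ (Set.Icc 0 1)ᶜ = 0)
    (hdrop : ∀ p ∈ Set.Icc (0 : ℝ) 1, c * (p - p₀) ^ 2 ≤ revenue μ p₀ - revenue μ p)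
    {n : ℕ} (hn : 1 ≤ n) {phat : (Fin n → ℝ) → ℝ} (hphat : IsERMStrategy phat) :
    revenue μ p₀ - ∫ y, revenue μ (phat y) ∂(Measure.pi fun _ : Fin n => μ)
      ≤ c * δ ^ 2 + 4 / (c * n) * (96 * (K * (Real.pi / δ)) + 3) := by
  have hn0 : (0 : ℝ) < n := by exact_mod_cast hn
  have hac : μ ≪ volume := Measure.absolutelyContinuous_of_le_smul hμ
  have : NullSingletonClass μ := ⟨fun x => hac (measure_singleton x)⟩
  let h : ℝ → Set.Icc (0 : ℝ) 1 → ℝ := fun y t => saleDiff p₀ y t / smoothDist p₀ δ t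
  let V : ℝ → ℝ := fun y => 96 * (smoothDist p₀ δ y)⁻¹ ^ 2 + 3
  -- `phat` is constrained only for samples in the unit cube. Projecting keeps `h` bounded
  -- everywhere and changes nothing almost surely.
  let q : (Fin n → ℝ) → Set.Icc (0 : ℝ) 1 := fun y => Set.projIcc 0 1 zero_le_one (phat y)
  have hq : Measurable q := continuous_projIcc.measurable.comp hphat.1
  have hm : Measurable (Function.uncurry h) := by
    refine ((measurable_saleDiff p₀).comp (measurable_fst.prodMk
      (measurable_subtype_coe.comp measurable_snd))).div ?_
    exact (measurable_smoothDist p₀ δ).comp (measurable_subtype_coe.comp measurable_snd)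
  have hB : ∀ y t, |h y t| ≤ 1 / δ := by
    intro y t
    rw [abs_div, abs_of_pos (smoothDist_pos p₀ hδ _)]
    exact div_le_div₀ zero_le_one (abs_saleDiff_le hp₀ t.2 y) hδ (le_smoothDist p₀ δ _)
  have hwint : Integrable (fun y => (smoothDist p₀ δ y)⁻¹ ^ 2) μ :=
    ((integrable_inv_smoothDist_sq p₀ hδ).smul_measure ENNReal.ofReal_ne_top).mono_measure hμ
  have hVint : Integrable V μ := (hwint.const_mul 96).add (integrable_const 3)
  have hV : ∫ y, V y ∂μ ≤ 96 * (K * (Real.pi / δ)) + 3 := by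
    simp only [V]
    rw [integral_add (hwint.const_mul 96) (integrable_const 3), integral_const_mul, integral_const,
      probReal_univ, one_smul]
    linarith [integral_inv_smoothDist_sq_le hK hμ p₀ hδ]
  have hmean : ∀ t, ∫ z, h z t ∂μ = (revenue μ t - revenue μ p₀) / smoothDist p₀ δ t := fun t => by
    simp only [h]
    rw [integral_div, integral_saleDiff]
  set X : (Fin n → ℝ) → ℝ := fun y => ∑ i, (h (y i) (q y) - ∫ z, h z (q y) ∂μ) with hX
  have hsymm : ∫ y, X y ^ 2 ∂(Measure.pi fun _ : Fin n => μ)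
      ≤ 4 * n * (96 * (K * (Real.pi / δ)) + 3) := by
    have := integral_sq_empirical_le (ι := Fin n) μ h hm hB V hVint
      (fun y τ => sum_sq_saleDiff_le p₀ hδ y τ) q hq
    rw [Fintype.card_fin] at this
    exact this.trans (mul_le_mul_of_nonneg_left hV (by positivity))
  have hXm : Measurable X := by
    refine Finset.measurable_sum _ fun i _ => Measurable.sub ?_ ?_
    · exact hm.comp (g := Function.uncurry h) (f := fun y : Fin n → ℝ => (y i, q y))
        ((measurable_pi_apply i).prodMk hq)
    · simp only [hmean]
      have hq' : Measurable fun y => (q y : ℝ) := measurable_subtype_coe.comp hq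
      exact (((measurable_revenue μ).comp hq').sub_const _).div
        ((measurable_smoothDist p₀ δ).comp hq')
  have hmeanB : ∀ t, |∫ z, h z t ∂μ| ≤ 1 / δ := fun t => by
    simpa using norm_integral_le_of_norm_le_const (μ := μ) (f := fun z => h z t)
      (Filter.Eventually.of_forall fun z => hB z t)
  have hXB : ∀ y, |X y| ≤ Fintype.card (Fin n) * (1 / δ + 1 / δ) := fun y =>
    abs_sum_le_card_mul fun i => (abs_sub _ _).trans (add_le_add (hB _ _) (hmeanB _))
  have hX2 : Integrable (fun y => X y ^ 2) (Measure.pi fun _ : Fin n => μ) :=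
    integrable_of_measurable_of_abs_le (B := (Fintype.card (Fin n) * (1 / δ + 1 / δ)) ^ 2)
      (hXm.pow_const 2) fun y => by
        rw [abs_pow]
        exact pow_le_pow_left₀ (abs_nonneg _) (hXB y) 2
  have hmem := ae_pi_mem_Icc hsupp n
  have hrint : Integrable (fun y => revenue μ (phat y)) (Measure.pi fun _ : Fin n => μ) := by
    refine Integrable.of_bound ((measurable_revenue μ).comp hphat.1).aestronglyMeasurable 1 ?_
    filter_upwards [hmem] with y hy
    obtain ⟨h0, h1⟩ := (hphat.2 y hy).1
    rw [Real.norm_eq_abs, revenue_eq_mul_measureReal_Ici,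
      abs_of_nonneg (mul_nonneg h0 measureReal_nonneg)]
    exact mul_le_one₀ h1 measureReal_nonneg measureReal_le_one
  have hbasic : ∀ᵐ y ∂(Measure.pi fun _ : Fin n => μ),
      revenue μ p₀ - revenue μ (phat y) ≤ c * δ ^ 2 + 1 / (c * n ^ 2) * X y ^ 2 := by
    filter_upwards [hmem] with y hy
    have herm := hphat.2 y hy
    have hqy : (q y : ℝ) = phat y := by
      simp only [q]
      rw [Set.projIcc_of_mem _ herm.1]
    have hD := smoothDist_pos p₀ hδ (phat y)
    have hD2 := smoothDist_sq p₀ δ (phat y)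
    have hdr := hdrop _ herm.1
    have hpos := sum_saleDiff_nonneg hn herm hp₀
    -- The mean of the revenue difference is minus the regret. Since the empirical sum is
    -- nonnegative, `n * r ≤ D * X`.
    have hXeq : smoothDist p₀ δ (phat y) * X y
        = ∑ i, saleDiff p₀ (y i) (phat y) + n * (revenue μ p₀ - revenue μ (phat y)) := by
      simp only [hX, hmean, h, hqy]
      rw [Finset.sum_sub_distrib, ← Finset.sum_div, Finset.sum_const, Finset.card_univ,
        Fintype.card_fin, nsmul_eq_mul]
      field_simp
      ring
    set r := revenue μ p₀ - revenue μ (phat y)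
    set D := smoothDist p₀ δ (phat y)
    have hr : r ≤ D * (X y / n) := by
      rw [← mul_div_assoc, le_div_iff₀ hn0]
      linarith
    -- The weight `c / 2` is chosen so that the quadratic drop gives `c / 2 * D ^ 2 ≤ r / 2 + c / 2
    -- * δ ^ 2`; the term `r / 2` is then absorbed on the left.
    have hyoung : D * (X y / n) ≤ c / 2 * D ^ 2 + 1 / (2 * c) * (X y / n) ^ 2 := by
      have : c / 2 * D ^ 2 + 1 / (2 * c) * (X y / n) ^ 2 - D * (X y / n)
          = 1 / (2 * c) * (c * D - X y / n) ^ 2 := by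
        field_simp
        ring
      have : 0 ≤ 1 / (2 * c) * (c * D - X y / n) ^ 2 := by positivity
      linarith
    have hfin : 1 / (c * n ^ 2) * X y ^ 2 = 2 * (1 / (2 * c) * (X y / n) ^ 2) := by
      field_simp
    rw [hfin]
    rw [hD2] at hyoung
    linarith
  have hmono := integral_mono_ae ((integrable_const (revenue μ p₀)).sub hrint)
    ((integrable_const (c * δ ^ 2)).add (hX2.const_mul (1 / (c * n ^ 2)))) hbasic
  simp only [Pi.sub_apply, Pi.add_apply] at hmono
  rw [integral_sub (integrable_const _) hrint,
    integral_add (integrable_const _) (hX2.const_mul _), integral_const, integral_const,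
    probReal_univ, one_smul, one_smul, integral_const_mul] at hmono
  refine hmono.trans (add_le_add_right ?_ _)
  calc 1 / (c * n ^ 2) * ∫ y, X y ^ 2 ∂(Measure.pi fun _ : Fin n => μ)
      ≤ 1 / (c * n ^ 2) * (4 * n * (96 * (K * (Real.pi / δ)) + 3)) :=
        mul_le_mul_of_nonneg_left hsymm (by positivity)
    _ = _ := by
        field_simp

end Regret

end UniformPricing

/-! ### Choice of the scale and the final rate. -/

theorem theorem5 (C₀ Cs Cb : ℝ) (hC₀ : 0 < C₀) (hCs : 0 < Cs) (hCb : 0 < Cb) :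
    ∃ C : ℝ, 0 < C ∧ ∀ n : ℕ, 1 ≤ n →
      ∀ phat : (Fin n → ℝ) → ℝ, UniformPricing.IsERMStrategy phat →
        ∀ μ ∈ UniformPricing.marginalClass C₀ Cs Cb,
          UniformPricing.optRevenue μ
              - ∫ y, UniformPricing.revenue μ (phat y) ∂(MeasureTheory.Measure.pi fun _ : Fin n => μ)
            ≤ C * (n : ℝ) ^ (-(2 / 3) : ℝ) := by
  have hπ := Real.pi_pos
  refine ⟨Cs / 2 + 4 / (Cs / 2) * (96 * ((1 + C₀) * Real.pi) + 3), by positivity, ?_⟩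
  intro n hn phat hphat μ hμ
  have hprob : IsProbabilityMeasure μ := hμ.1
  obtain ⟨hle, hsupp, p₀, hp₀, hopt, hdrop⟩ :=
    UniformPricing.exists_quadratic_drop_of_mem_marginalClass hC₀.le hμ
  have hn1 : (1 : ℝ) ≤ n := by exact_mod_cast hn
  have hn0 : (0 : ℝ) < n := by linarith
  -- The scale `δ = n^(-1/3)` equates `δ²` with `1 / (n δ)`; the leftover `1 / n` term is of smaller
  -- order.
  have hδ : (0 : ℝ) < (n : ℝ) ^ (-(1 / 3) : ℝ) := Real.rpow_pos_of_pos hn0 _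
  have h := UniformPricing.regret_le (by positivity : (0 : ℝ) ≤ 1 + C₀) (half_pos hCs) hδ hp₀ hle
    hsupp hdrop hn hphat
  rw [hopt]
  refine h.trans ?_
  have h1 : ((n : ℝ) ^ (-(1 / 3) : ℝ)) ^ 2 = (n : ℝ) ^ (-(2 / 3) : ℝ) := by
    rw [← Real.rpow_natCast, ← Real.rpow_mul hn0.le]
    norm_num
  have h2 : (n : ℝ)⁻¹ * ((n : ℝ) ^ (-(1 / 3) : ℝ))⁻¹ = (n : ℝ) ^ (-(2 / 3) : ℝ) := by
    rw [← Real.rpow_neg hn0.le, ← Real.rpow_neg_one, ← Real.rpow_add hn0]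
    norm_num
  have h3 : (n : ℝ)⁻¹ ≤ (n : ℝ) ^ (-(2 / 3) : ℝ) := by
    rw [← Real.rpow_neg_one]
    exact Real.rpow_le_rpow_of_exponent_le hn1 (by norm_num)
  have h4 : 4 / (Cs / 2 * n) * (96 * ((1 + C₀) * (Real.pi / (n : ℝ) ^ (-(1 / 3) : ℝ))) + 3)
      = 4 / (Cs / 2) * (96 * ((1 + C₀) * Real.pi) * ((n : ℝ)⁻¹ * ((n : ℝ) ^ (-(1 / 3) : ℝ))⁻¹)
        + 3 * (n : ℝ)⁻¹) := by
    field_simp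
  have h5 : 4 / (Cs / 2) * (3 * (n : ℝ)⁻¹) ≤ 4 / (Cs / 2) * (3 * (n : ℝ) ^ (-(2 / 3) : ℝ)) := by
    gcongr
  rw [h4, h1, h2]
  linarith
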